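/- **Theorem.** For a positive sequence $M=(M_k)_{k\ge0}$ put $\mu_0=1$ and $\mu_k=M_k/M_{k-1}$ for $k\ge1$. Call $M$ a *weight sequence* if $M_0=1$, $1=\mu_0\le\mu_1\le\mu_2\le\cdots$ and $\mu_k\to\infty$; call it *non-quasianalytic* if $\sum_{k\ge1}1/\mu_k<\infty$. A *non-quasianalytic weight matrix* is a family $\mathfrak M=\{M^{(x)}:x>0\}$ of non-quasianalytic weight sequences such that $M^{(x)}_k\le M^{(y)}_k$ for all $k$ whenever $x\le y$. For a family $\mathfrak N$ of positive sequences let $\Lambda^{\{\mathfrak N\}}$ be the set of all $a\in\mathbb C^{\mathbb N}$ for which there are $N\in\mathfrak N$ and an integer $\sigma\ge1$ with $\sup_{k\ge0}|a_k|/(\sigma^kN_k)<\infty$, let $\mathcal E^{\{\mathfrak N\}}(\mathbb R)$ be the set of all $f\in C^\infty(\mathbb R,\mathbb C)$ such that for every $n\in\mathbb N$ there are $N\in\mathfrak N$ and an integer $\sigma\ge1$ with $\sup_{x\in[-n,n],\,k\ge0}|f^{(k)}(x)|/(\sigma^kN_k)<\infty$, and let $j^\infty f=(f^{(k)}(0))_{k\ge0}$.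 For a positive sequence $M'$ and a non-quasianalytic weight sequence $M$ write $M'\prec_{SV}M$ if there is an integer $s\ge1$ with $$\sup_{j\ge1}\ \frac{\sup_{0\le i<j}\big(\frac{M'_j}{s^jM_i}\big)^{1/(j-i)}}{j}\sum_{k\ge j}\frac1{\mu_k}<\infty .$$ Let $\mathfrak M$ be a non-quasianalytic weight matrix and let $\mathfrak M'$ be a family of positive sequences such that $\liminf_{k\to\infty}(M'_k/k!)^{1/k}>0$ (the value $+\infty$ being allowed) for all $M'\in\mathfrak M'$. Then the following are equivalent: 1. $\Lambda^{\{\mathfrak M'\}}\subseteq j^\infty\mathcal E^{\{\mathfrak M\}}(\mathbb R)$; 2. for every $M'\in\mathfrak M'$ there is $M\in\mathfrak M$ such that $M'\prec_{SV}M$. -/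

import Mathlib

open Filter Topology
open scoped ContDiff Nat

namespace Ultradiff

noncomputable section

/-- The quotients `μ_0 = 1`, `μ_k = M_k / M_{k-1}` (`k ≥ 1`) of a sequence `M`. -/
def quot (M : ℕ → ℝ) : ℕ → ℝ
  | 0 => 1
  | k + 1 => M (k + 1) / M k

/-- A positive sequence. -/
def IsPositive (M : ℕ → ℝ) : Prop := ∀ k, 0 < M k

/-- A weight sequence: `M_k = μ_0 μ_1 ⋯ μ_k` with `1 = μ_0 ≤ μ_1 ≤ μ_2 ≤ ⋯` and `μ_k → ∞`. -/
structure IsWeightSequence (M : ℕ → ℝ) : Prop where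
  pos : IsPositive M
  zero : M 0 = 1
  mono : Monotone (quot M)
  tendsto : Tendsto (quot M) atTop atTop

/-- A weight sequence is the sequence of partial products of its quotients. -/
theorem IsWeightSequence.eq_prod {M : ℕ → ℝ} (h : IsWeightSequence M) (k : ℕ) :
    M k = ∏ l ∈ Finset.range (k + 1), quot M l := by
  induction k with
  | zero => simp [quot, h.zero]
  | succ k ih =>
    rw [Finset.prod_range_succ, ← ih]
    have := (h.pos k).ne'
    simp only [quot]
    field_simp

/-- Non-quasianalyticity: `∑_{k ≥ 1} 1 / μ_k < ∞`. -/
def IsNonQuasianalytic (M : ℕ → ℝ) : Prop := Summable fun k : ℕ => 1 / quot M (k + 1)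

/-- A weight matrix: a family `(M^{(x)})_{x > 0}` of weight sequences with `M^{(x)} ≤ M^{(y)}`
(termwise) for `x ≤ y`. -/
structure IsWeightMatrix (𝔐 : Set.Ioi (0 : ℝ) → ℕ → ℝ) : Prop where
  weight : ∀ x, IsWeightSequence (𝔐 x)
  mono : Monotone 𝔐

/-- A weight matrix all of whose members are non-quasianalytic. -/
structure IsNonQuasianalyticWeightMatrix (𝔐 : Set.Ioi (0 : ℝ) → ℕ → ℝ) : Prop
    extends IsWeightMatrix 𝔐 where
  nonQuasianalytic : ∀ x, IsNonQuasianalytic (𝔐 x)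

/-- The sequence space `Λ^{𝔐}` of Roumieu type of a family `𝔐` of positive sequences (as a set):
the union over `M ∈ 𝔐` and integers `σ ≥ 1` of the spaces of complex sequences `a` with
`sup_k |a_k| / (σ^k M_k) < ∞`. -/
def seqSpace {ι : Type*} (𝔐 : ι → ℕ → ℝ) : Set (ℕ → ℂ) :=
  {a | ∃ i : ι, ∃ σ : ℕ, 1 ≤ σ ∧ ∃ C : ℝ, ∀ k : ℕ, ‖a k‖ ≤ C * ((σ : ℝ) ^ k * 𝔐 i k)}

/-- The function space `ℰ^{𝔐}(ℝ)` of Roumieu type: smooth `f : ℝ → ℂ` such that for every `n`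
there are `M ∈ 𝔐` and an integer `σ ≥ 1` with
`sup_{x ∈ [-n,n], k} |f^{(k)}(x)| / (σ^k M_k) < ∞`. -/
def funSpace {ι : Type*} (𝔐 : ι → ℕ → ℝ) : Set (ℝ → ℂ) :=
  {f | ContDiff ℝ ∞ f ∧
    ∀ n : ℕ, ∃ i : ι, ∃ σ : ℕ, 1 ≤ σ ∧ ∃ C : ℝ,
      ∀ x ∈ Set.Icc (-(n : ℝ)) (n : ℝ), ∀ k : ℕ,
        ‖iteratedDeriv k f x‖ ≤ C * ((σ : ℝ) ^ k * 𝔐 i k)}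

/-- The Borel map `j^∞ f = (f^{(k)}(0))_k`. -/
def borel (f : ℝ → ℂ) : ℕ → ℂ := fun k => iteratedDeriv k f 0

/-- The relation `M' ≺_SV M`: for some integer `s ≥ 1`,
`sup_{j ≥ 1} (1/j) (sup_{0 ≤ i < j} (M'_j / (s^j M_i))^{1/(j-i)}) ∑_{k ≥ j} 1/μ_k < ∞`. -/
def PrecSV (M' M : ℕ → ℝ) : Prop :=
  ∃ s : ℕ, 1 ≤ s ∧ ∃ C : ℝ, ∀ j : ℕ, 1 ≤ j →
    (⨆ i : Fin j, (M' j / ((s : ℝ) ^ j * M i)) ^ (1 / ((j : ℝ) - ((i : ℕ) : ℝ)))) / (j : ℝ)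
      * ∑' k : ℕ, 1 / quot M (j + k) ≤ C

/-- `liminf_{k → ∞} (M_k / k!)^{1/k} > 0`; the lower limit is taken in the extended reals, so that
the value `∞` is allowed. -/
def LiminfRootPos (M : ℕ → ℝ) : Prop :=
  0 < liminf (fun k : ℕ => (((M k / (k ! : ℝ)) ^ (1 / (k : ℝ)) : ℝ) : EReal)) atTop

end

end Ultradiff

/-! Both directions reduce to the sequences that vanish except for the entry `M'_j` in one degree
`j`, treated uniformly in `j`.

Necessity. A Baire argument on `{0,1}^ℕ` (`exists_uniform_jets`) gives, for every `j`, a function on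
`[0,1]` with this jet at `0` and derivatives bounded by `C σ^k M_k`, where `M`, `C`, `σ` do not
depend on `j`. Subtracting `M'_j x^j / j!` leaves a flat function. By Bang's theorem
(`IsJet.norm_le_of_flat`) its derivatives of order below `j` stay small up to a distance
proportional to `∑_{k≥j} 1/μ_k`. Hence at such a distance `t` the monomial itself obeys `M'_j
t^{j-i}/(j-i)! ≤ 2 C σ^i M_i` (`IsJet.monomial_le`), and taking roots of order `j-i` gives `≺_SV`.

Sufficiency. The condition yields a scale `α_j`, namely `C j / ∑_{k≥j} 1/μ_k` capped by `μ_j`, with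
`M'_j ≤ s^j M_i α_j^{j-i}` (`PrecSV.exists_scale`). Multiply `x^j / j!` by a cutoff of width
comparable to `h j / α_j`, obtained by repeated averaging over radii proportional to `1/α_j` (`j`
times) and then to `1/μ_k`. The sum of the radii fits this width. For small `h` the product is so
small that the series with coefficients `a_j` converges geometrically, at the price of a larger rate
`ρ` in `ρ^k M_k` (`exists_function_with_monomial_jet`). -/

namespace Ultradiff

/-! ### Bang's theorem for flat jets -/

/-- A family of functions on `[0, b]` each of which is the derivative of the preceding one. -/
def IsJet (b : ℝ) (F : ℕ → ℝ → ℂ) : Prop :=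
  ∀ k, ∀ x ∈ Set.Icc 0 b, HasDerivWithinAt (F k) (F (k + 1) x) (Set.Icc 0 b) x

theorem IsJet.mono {b c : ℝ} {F : ℕ → ℝ → ℂ} (hF : IsJet b F) (hcb : c ≤ b) : IsJet c F :=
  fun k x hx => (hF k x ⟨hx.1, hx.2.trans hcb⟩).mono (Set.Icc_subset_Icc_right hcb)

theorem IsJet.sub {b : ℝ} {F G : ℕ → ℝ → ℂ} (hF : IsJet b F) (hG : IsJet b G) :
    IsJet b (fun k x => F k x - G k x) :=
  fun k x hx => (hF k x hx).sub (hG k x hx)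

theorem IsJet.of_contDiff {f : ℝ → ℂ} (hf : ContDiff ℝ ∞ f) (b : ℝ) :
    IsJet b (fun k => iteratedDeriv k f) := by
  intro k x _
  have h : DifferentiableAt ℝ (iteratedDeriv k f) x :=
    (hf.differentiable_iteratedDeriv k (by exact_mod_cast WithTop.coe_lt_top _)) x
  simpa only [iteratedDeriv_succ] using h.hasDerivAt.hasDerivWithinAt

/-- The exponential growth step in Bang's argument. -/
theorem IsJet.norm_le_mul_exp {b : ℝ} {F : ℕ → ℝ → ℂ} (hF : IsJet b F) {B : ℕ → ℝ}
    (hB : ∀ k, 0 < B k) (hFB : ∀ k, ∀ x ∈ Set.Icc 0 b, ‖F k x‖ ≤ B k) {q : ℕ} {ρ E ν : ℝ}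
    (hρ : 0 < ρ) (hBρ : ∀ k < q, B (k + 1) ≤ ρ * B k) (hE : 1 ≤ E) (hν : 1 ≤ ν * E ^ q)
    {u v : ℝ} (hu : 0 ≤ u) (huv : u ≤ v) (hv : v ≤ b)
    (hFu : ∀ k, ‖F k u‖ ≤ ν * (E ^ k * B k)) (k : ℕ) :
    ‖F k v‖ ≤ ν * (E ^ k * B k) * Real.exp (E * ρ * (v - u)) := by
  have hE0 : 0 < E := by linarith
  have hν0 : 0 < ν := by
    by_contra! h
    have := mul_nonpos_of_nonpos_of_nonneg h (pow_pos hE0 q).le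
    linarith
  have hc : ∀ k, 0 < ν * (E ^ k * B k) := fun k => by have := hB k; positivity
  have high : ∀ k, q ≤ k → ∀ x ∈ Set.Icc u v,
      ‖F k x‖ ≤ ν * (E ^ k * B k) * Real.exp (E * ρ * (x - u)) := by
    intro k hk x hx
    have h1 : 1 ≤ ν * E ^ k := hν.trans (by gcongr)
    have h2 : 1 ≤ Real.exp (E * ρ * (x - u)) :=
      Real.one_le_exp (mul_nonneg (by positivity) (by linarith [hx.1]))
    calc ‖F k x‖ ≤ B k := hFB k x ⟨hu.trans hx.1, hx.2.trans hv⟩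
      _ ≤ (ν * E ^ k) * B k := le_mul_of_one_le_left (hB k).le h1
      _ = ν * (E ^ k * B k) := by ring
      _ ≤ _ := le_mul_of_one_le_right (hc k).le h2
  -- Descending induction on the order. From order `q` on, the a priori bound suffices because `ν *
  -- E ^ q ≥ 1`; below `q`, the bound for `F (k + 1)` is at most the derivative of the majorant of
  -- `F k`.
  have low : ∀ d k, k + d = q → ∀ x ∈ Set.Icc u v,
      ‖F k x‖ ≤ ν * (E ^ k * B k) * Real.exp (E * ρ * (x - u)) := by
    intro d
    induction d with
    | zero => exact fun k hk => high k (by omega)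
    | succ d ih =>
      intro k hk
      have hsub : Set.Icc u v ⊆ Set.Icc 0 b := Set.Icc_subset_Icc hu hv
      refine image_norm_le_of_norm_deriv_right_le_deriv_boundary (f' := F (k + 1))
        (B' := fun x => ν * (E ^ k * B k) * (Real.exp (E * ρ * (x - u)) * (E * ρ * 1)))
        (fun x hx => ((hF k x (hsub hx)).mono hsub).continuousWithinAt) ?_ ?_ ?_ ?_
      · intro x hx
        exact ((hF k x (hsub (Set.Ico_subset_Icc_self hx))).mono hsub).mono_of_mem_nhdsWithin
          (Icc_mem_nhdsGE_of_mem hx)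
      · simpa using hFu k
      · intro x
        exact ((((hasDerivAt_id x).sub_const u).const_mul (E * ρ)).exp).const_mul _
      · intro x hx
        refine (ih (k + 1) (by omega) x (Set.Ico_subset_Icc_self hx)).trans ?_
        have h1 := hBρ k (by omega)
        calc ν * (E ^ (k + 1) * B (k + 1)) * Real.exp (E * ρ * (x - u))
            ≤ ν * (E ^ (k + 1) * (ρ * B k)) * Real.exp (E * ρ * (x - u)) := by gcongr
          _ = _ := by ring
  rcases le_total q k with h | h
  · exact high k h v ⟨huv, le_rfl⟩
  · exact low (q - k) k (by omega) v ⟨huv, le_rfl⟩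

/-- Bang's theorem: a flat jet grows slowly away from the origin. -/
theorem IsJet.norm_le_of_flat {b : ℝ} {F : ℕ → ℝ → ℂ} (hF : IsJet b F) {B : ℕ → ℝ}
    (hB : ∀ k, 0 < B k) (hFB : ∀ k, ∀ x ∈ Set.Icc 0 b, ‖F k x‖ ≤ B k) {ρ : ℕ → ℝ} {E : ℝ}
    (hρ : ∀ q, 1 ≤ q → 0 < ρ q) (hBρ : ∀ q, ∀ k < q, B (k + 1) ≤ ρ q * B k) (hE : 2 ≤ E)
    (hF0 : ∀ k, F k 0 = 0) (N j : ℕ) (hj : 1 ≤ j) {x : ℝ} (hx : x ∈ Set.Icc 0 b)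
    (hxN : x ≤ ∑ q ∈ Finset.Ico j (j + N), Real.log 2 / (E * ρ q)) (k : ℕ) :
    ‖F k x‖ ≤ 2 * (E ^ j)⁻¹ * (E ^ k * B k) := by
  have hE0 : 0 < E := by linarith
  induction N generalizing j x k with
  | zero =>
    have hx0 : x = 0 := le_antisymm (by simpa using hxN) hx.1
    have := hB k
    rw [hx0, hF0, norm_zero]
    positivity
  | succ N ih =>
    -- The piece of length `log 2 / (E * ρ j)` farthest from the origin is split off. Up to `S` the
    -- bound of level `j + 1` holds, which is half as large as needed since `E ≥ 2`; across the last
    -- piece it at most doubles.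
    set S := ∑ q ∈ Finset.Ico (j + 1) (j + 1 + N), Real.log 2 / (E * ρ q) with hS
    have hlog : 0 < Real.log 2 := Real.log_pos (by norm_num)
    have hS0 : 0 ≤ S := Finset.sum_nonneg fun q hq => by
      have := hρ q (by have := Finset.mem_Ico.1 hq; omega)
      positivity
    have hstep : 2 * (E ^ (j + 1))⁻¹ ≤ (E ^ j)⁻¹ := by
      rw [pow_succ, mul_inv]
      have h1 : 2 * E⁻¹ ≤ 1 := by rw [← div_eq_mul_inv, div_le_one hE0]; exact hE
      have h2 : 0 < (E ^ j)⁻¹ := by positivity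
      nlinarith
    have hprev : ∀ y ∈ Set.Icc 0 b, y ≤ S → ∀ k, ‖F k y‖ ≤ (E ^ j)⁻¹ * (E ^ k * B k) := by
      intro y hy hyS k
      refine (ih (j + 1) (by omega) hy hyS k).trans ?_
      have := hB k
      gcongr
    rcases le_total x S with h | h
    · refine (hprev x hx h k).trans ?_
      have := hB k
      have h3 : 0 ≤ (E ^ j)⁻¹ * (E ^ k * B k) := by positivity
      linarith
    · have hρj := hρ j hj
      have h1 := hF.norm_le_mul_exp hB hFB hρj (hBρ j) (by linarith : (1 : ℝ) ≤ E)
        (ν := (E ^ j)⁻¹) (by rw [inv_mul_cancel₀ (by positivity)]) hS0 h hx.2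
        (hprev S ⟨hS0, h.trans hx.2⟩ le_rfl) k
      have hexp : Real.exp (E * ρ j * (x - S)) ≤ 2 := by
        rw [← Real.le_log_iff_exp_le (by norm_num)]
        have h2 : x - S ≤ Real.log 2 / (E * ρ j) := by
          rw [Finset.sum_eq_sum_Ico_succ_bot (by omega)] at hxN
          have : j + (N + 1) = j + 1 + N := by ring
          rw [this] at hxN
          linarith
        calc E * ρ j * (x - S) ≤ E * ρ j * (Real.log 2 / (E * ρ j)) := by gcongr
          _ = Real.log 2 := by field_simp
      calc ‖F k x‖ ≤ _ := h1
        _ ≤ (E ^ j)⁻¹ * (E ^ k * B k) * 2 := by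
          have := hB k
          gcongr
        _ = _ := by ring

/-! ### Comparison of a jet with a monomial -/

theorem quot_pos {M : ℕ → ℝ} (hM : IsWeightSequence M) (k : ℕ) : 0 < quot M k := by
  have := hM.mono (Nat.zero_le k)
  exact lt_of_lt_of_le one_pos this

theorem succ_eq_quot_mul {M : ℕ → ℝ} (hM : IsWeightSequence M) (k : ℕ) :
    M (k + 1) = quot M (k + 1) * M k := by
  have := (hM.pos k).ne'
  simp only [quot]
  field_simp

theorem summable_one_div_quot {M : ℕ → ℝ} (hM : IsNonQuasianalytic M) (j : ℕ) :
    Summable fun k => 1 / quot M (j + k) := by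
  have h : Summable fun k => 1 / quot M k := (summable_nat_add_iff 1).1 hM
  simpa only [add_comm] using (summable_nat_add_iff j).2 h

theorem hasDerivAt_pow_div_factorial (n : ℕ) (x : ℝ) :
    HasDerivAt (fun y : ℝ => y ^ (n + 1) / ((n + 1)! : ℝ)) (x ^ n / (n ! : ℝ)) x := by
  refine ((hasDerivAt_pow (n + 1) x).div_const _).congr_deriv ?_
  have : (n ! : ℝ) ≠ 0 := by positivity
  rw [Nat.factorial_succ]
  push_cast
  field_simp

/-- The monomial `x ^ j / j!` and its derivatives. -/
noncomputable def monomialJet (j k : ℕ) (x : ℝ) : ℝ :=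
  if k ≤ j then x ^ (j - k) / ((j - k)! : ℝ) else 0

theorem hasDerivAt_monomialJet (j k : ℕ) (x : ℝ) :
    HasDerivAt (monomialJet j k) (monomialJet j (k + 1) x) x := by
  unfold monomialJet
  rcases lt_trichotomy k j with h | h | h
  · obtain ⟨d, rfl⟩ : ∃ d, j = k + 1 + d := ⟨j - k - 1, by omega⟩
    have e1 : k + 1 + d - k = d + 1 := by omega
    simp only [show k ≤ k + 1 + d by omega, show k + 1 ≤ k + 1 + d by omega, if_true, e1,
      Nat.add_sub_cancel_left]
    exact hasDerivAt_pow_div_factorial d x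
  · subst h
    simpa using hasDerivAt_const x (1 : ℝ)
  · simp only [show ¬ k ≤ j by omega, show ¬ k + 1 ≤ j by omega, if_false]
    exact hasDerivAt_const x (0 : ℝ)

theorem monomialJet_zero (j k : ℕ) : monomialJet j k 0 = if k = j then 1 else 0 := by
  unfold monomialJet
  rcases lt_trichotomy k j with h | h | h
  · rw [if_pos h.le, if_neg h.ne, zero_pow (by omega), zero_div]
  · simp [h]
  · rw [if_neg (by omega), if_neg h.ne']

theorem monomialJet_nonneg (j k : ℕ) {x : ℝ} (hx : 0 ≤ x) : 0 ≤ monomialJet j k x := by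
  unfold monomialJet
  split_ifs <;> positivity

theorem monomialJet_le (j k : ℕ) {x y : ℝ} (hx : 0 ≤ x) (hxy : x ≤ y) :
    monomialJet j k x ≤ monomialJet j k y := by
  unfold monomialJet
  split_ifs
  · gcongr
  · exact le_rfl

theorem isJet_monomialJet (m : ℝ) (j : ℕ) (b : ℝ) :
    IsJet b (fun k x => ((m * monomialJet j k x : ℝ) : ℂ)) :=
  fun k x _ => (((hasDerivAt_monomialJet j k x).const_mul m).ofReal_comp).hasDerivWithinAt

/-- If the jet at the origin is `m` in degree `j` and `0` otherwise, then `m` cannot be too large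
in comparison with the bounds of the jet. -/
theorem IsJet.monomial_le {M : ℕ → ℝ} (hM : IsWeightSequence M) (hqa : IsNonQuasianalytic M)
    {F : ℕ → ℝ → ℂ} (hF : IsJet 1 F) {C σ m : ℝ} (hC : 0 < C) (hσ : 0 < σ) (hm : 0 < m) {j : ℕ}
    (hj : 1 ≤ j) (hF0 : ∀ k, F k 0 = if k = j then (m : ℂ) else 0)
    (hFM : ∀ k, ∀ x ∈ Set.Icc (0 : ℝ) 1, ‖F k x‖ ≤ C * (σ ^ k * M k)) {t : ℝ} (ht0 : 0 ≤ t)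
    (ht1 : t ≤ 1) (ht : t ≤ Real.log 2 / (8 * σ) * ∑' k, 1 / quot M (j + k)) {k : ℕ} (hk : k < j) :
    m * (t ^ (j - k) / ((j - k)! : ℝ)) ≤ 2 * (C * (σ ^ k * M k)) := by
  by_contra! hcon
  have hD : ∀ k, 0 < C * (σ ^ k * M k) := fun k => by have := hM.pos k; positivity
  -- `y` is the first point at which some derivative of the monomial of order below `j` reaches
  -- twice the bound for `F`; the `i`-th one does so at `r i`.
  have hex : ∃ y ∈ Set.Icc 0 t, y < t ∧
      (∀ i < j, m * monomialJet j i y ≤ 2 * (C * (σ ^ i * M i))) ∧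
      ∃ i < j, m * monomialJet j i y = 2 * (C * (σ ^ i * M i)) := by
    let r : ℕ → ℝ := fun i =>
      (2 * (C * (σ ^ i * M i)) * ((j - i)! : ℝ) / m) ^ (1 / ((j - i : ℕ) : ℝ))
    have hr0 : ∀ i, 0 ≤ r i := fun i => by have := hD i; positivity
    have hr : ∀ i < j, m * monomialJet j i (r i) = 2 * (C * (σ ^ i * M i)) := by
      intro i hi
      have := hD i
      have h1 : r i ^ (j - i) = 2 * (C * (σ ^ i * M i)) * ((j - i)! : ℝ) / m := by
        simp only [r, one_div]
        exact Real.rpow_inv_natCast_pow (by positivity) (by omega)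
      have hfac : ((j - i)! : ℝ) ≠ 0 := by positivity
      rw [monomialJet, if_pos hi.le, h1]
      field_simp
    obtain ⟨i, hi, hmin⟩ := Finset.exists_min_image (Finset.range j) r ⟨0, by simp; omega⟩
    have hi' := Finset.mem_range.1 hi
    refine ⟨r i, ⟨hr0 i, ?_⟩, ?_, ?_, i, hi', hr i hi'⟩
    rotate_left
    · refine (hmin k (by simpa using hk)).trans_lt ?_
      by_contra! h
      have := monomialJet_le j k ht0 h
      have h2 := hr k hk
      rw [monomialJet, if_pos hk.le] at this
      nlinarith
    · intro l hl
      rw [← hr l hl]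
      have := monomialJet_le j l (hr0 i) (hmin l (by simpa using hl))
      gcongr
    · refine (hmin k (by simpa using hk)).trans ?_
      by_contra! h
      have := monomialJet_le j k ht0 h.le
      have h2 := hr k hk
      rw [monomialJet, if_pos hk.le] at this
      nlinarith
  obtain ⟨y, hy, hyt, hle, i, hi, hieq⟩ := hex
  have hmj : m ≤ C * (σ ^ j * M j) := by
    have := hFM j 0 (by simp)
    rwa [hF0, if_pos rfl, Complex.norm_real, Real.norm_of_nonneg hm.le] at this
  have hle' : ∀ l, ∀ x ∈ Set.Icc 0 y, m * monomialJet j l x ≤ 2 * (C * (σ ^ l * M l)) := by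
    intro l x hx
    rcases lt_trichotomy l j with h | h | h
    · refine le_trans ?_ (hle l h)
      have := monomialJet_le j l hx.1 hx.2
      gcongr
    · subst h
      have := hD l
      simp only [monomialJet, le_refl, if_true, Nat.sub_self, pow_zero, Nat.factorial_zero,
        Nat.cast_one, div_one, mul_one]
      linarith
    · have := hD l
      rw [monomialJet, if_neg (by omega), mul_zero]
      positivity
  have hG := (hF.mono (hy.2.trans ht1)).sub (isJet_monomialJet m j y)
  -- Because `y < t` strictly, a finite partial sum of the series already reaches `y`.
  obtain ⟨N, hN⟩ : ∃ N, y ≤ ∑ q ∈ Finset.Ico j (j + N),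
      Real.log 2 / (8 * (σ * quot M q)) := by
    have hs : Tendsto (fun N => Real.log 2 / (8 * σ) * ∑ q ∈ Finset.range N, 1 / quot M (j + q))
        atTop (𝓝 (Real.log 2 / (8 * σ) * ∑' k, 1 / quot M (j + k))) :=
      ((summable_one_div_quot hqa j).hasSum.tendsto_sum_nat).const_mul _
    obtain ⟨N, hN⟩ := (hs.eventually (lt_mem_nhds (hyt.trans_le ht))).exists
    refine ⟨N, hN.le.trans_eq ?_⟩
    rw [Finset.sum_Ico_eq_sum_range, Nat.add_sub_cancel_left, Finset.mul_sum]
    refine Finset.sum_congr rfl fun q _ => ?_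
    rw [div_mul_div_comm, mul_one, mul_assoc]
  have hGB : ∀ l, ∀ x ∈ Set.Icc 0 y,
      ‖F l x - ((m * monomialJet j l x : ℝ) : ℂ)‖ ≤ 3 * (C * (σ ^ l * M l)) := by
    intro l x hx
    refine (norm_sub_le _ _).trans ?_
    have h1 := hFM l x ⟨hx.1, hx.2.trans (hy.2.trans ht1)⟩
    have h2 := hle' l x hx
    rw [Complex.norm_real, Real.norm_of_nonneg (mul_nonneg hm.le (monomialJet_nonneg j l hx.1))]
    linarith
  have hfin := hG.norm_le_of_flat (B := fun l => 3 * (C * (σ ^ l * M l)))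
    (fun l => by have := hD l; positivity) hGB (ρ := fun q => σ * quot M q) (E := 8)
    (fun q _ => mul_pos hσ (quot_pos hM q)) (fun q l hl => by
      have h1 : quot M (l + 1) ≤ quot M q := hM.mono hl
      have h2 := hM.pos l
      rw [succ_eq_quot_mul hM l]
      calc 3 * (C * (σ ^ (l + 1) * (quot M (l + 1) * M l)))
          ≤ 3 * (C * (σ ^ (l + 1) * (quot M q * M l))) := by gcongr
        _ = _ := by ring) (by norm_num) (fun l => by
      rw [hF0, monomialJet_zero]
      split_ifs <;> simp) N j hj (x := y) ⟨hy.1, le_rfl⟩ hN i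
  -- At `y` the monomial term is twice the bound and `F i` at most once, so their difference is at
  -- least the bound; Bang's theorem with `E = 8` and `i < j` allows only 3/4 of it.
  have h8 : 2 * ((8 : ℝ) ^ j)⁻¹ * (8 ^ i * (3 * (C * (σ ^ i * M i)))) ≤
      3 / 4 * (C * (σ ^ i * M i)) := by
    have h1 : ((8 : ℝ) ^ j)⁻¹ * 8 ^ i ≤ 1 / 8 := by
      rw [inv_mul_le_iff₀ (by positivity), mul_one_div, le_div_iff₀ (by norm_num), ← pow_succ]
      exact pow_le_pow_right₀ (by norm_num) hi
    have := hD i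
    nlinarith
  have h9 := hFM i y ⟨hy.1, hy.2.trans ht1⟩
  have h10 : ‖((m * monomialJet j i y : ℝ) : ℂ)‖ = 2 * (C * (σ ^ i * M i)) := by
    rw [hieq, Complex.norm_real, Real.norm_of_nonneg (by have := hD i; positivity)]
  have h11 := norm_sub_norm_le ((m * monomialJet j i y : ℝ) : ℂ) (F i y)
  rw [norm_sub_rev] at h11
  have := hD i
  linarith

/-! ### Compactness and the Baire argument -/

/-- The families of functions on `[0, 1]` bounded by `L` and satisfying Taylor's formula of order
one; these are the smooth functions with derivatives bounded by `L`. -/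
def boundedJets (L : ℕ → ℝ) : Set (ℕ × ℝ → ℂ) :=
  {F | (∀ p, F p ∈ Metric.closedBall (0 : ℂ) (L p.1)) ∧
    ∀ k, ∀ x ∈ Set.Icc (0 : ℝ) 1, ∀ y ∈ Set.Icc (0 : ℝ) 1,
      ‖F (k, y) - F (k, x) - (y - x : ℝ) * F (k + 1, x)‖ ≤ L (k + 2) * (y - x) ^ 2}

theorem isClosed_setOf_forall {α : Type*} {ι : Sort*} [TopologicalSpace α] {p : ι → α → Prop}
    (h : ∀ i, IsClosed {a | p i a}) : IsClosed {a | ∀ i, p i a} := by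
  rw [show {a | ∀ i, p i a} = ⋂ i, {a | p i a} by ext; simp]
  exact isClosed_iInter h

/-- Each condition involves finitely many values of `F`, hence is closed under pointwise
convergence, and Tychonoff's theorem applies. This is why differentiability is encoded by Taylor
inequalities. -/
theorem isCompact_boundedJets (L : ℕ → ℝ) : IsCompact (boundedJets L) := by
  have hK : IsCompact (Set.univ.pi fun p : ℕ × ℝ => Metric.closedBall (0 : ℂ) (L p.1)) :=
    isCompact_univ_pi fun p => isCompact_closedBall _ _
  refine hK.of_isClosed_subset ?_ fun F hF p _ => hF.1 p
  refine IsClosed.inter ?_ ?_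
  · refine isClosed_setOf_forall fun p => ?_
    exact Metric.isClosed_closedBall.preimage (continuous_apply p)
  · refine isClosed_setOf_forall fun k => isClosed_setOf_forall fun x =>
      isClosed_setOf_forall fun _ => isClosed_setOf_forall fun y => isClosed_setOf_forall fun _ =>
        isClosed_le ?_ continuous_const
    fun_prop

theorem isJet_of_mem_boundedJets {L : ℕ → ℝ} {F : ℕ × ℝ → ℂ} (hF : F ∈ boundedJets L) :
    IsJet 1 fun k x => F (k, x) := by
  intro k x hx
  rw [hasDerivWithinAt_iff_isLittleO]
  have h1 : (fun y => F (k, y) - F (k, x) - (y - x) • F (k + 1, x))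
      =O[𝓝[Set.Icc 0 1] x] fun y => (y - x) ^ 2 := by
    refine Asymptotics.IsBigO.of_bound (L (k + 2)) ?_
    filter_upwards [self_mem_nhdsWithin] with y hy
    rw [Real.norm_of_nonneg (sq_nonneg _)]
    exact hF.2 k x hx y hy
  refine h1.trans_isLittleO ?_
  have h2 : (fun y : ℝ => (y - x) ^ 2) =o[𝓝 x] fun y => (y - x) := by
    simpa using Asymptotics.isLittleO_pow_sub_sub x (by norm_num : 1 < 2)
  exact h2.mono nhdsWithin_le_nhds

/-- The mean value inequality is used twice: for `F (k + 1)`, then for `F k` minus its tangent. The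
value `0` outside the interval only serves to stay in the balls. -/
theorem IsJet.mem_boundedJets {L : ℕ → ℝ} {F : ℕ → ℝ → ℂ} (hF : IsJet 1 F)
    (hL : ∀ k, ∀ x ∈ Set.Icc (0 : ℝ) 1, ‖F k x‖ ≤ L k) :
    (fun p : ℕ × ℝ => if p.2 ∈ Set.Icc (0 : ℝ) 1 then F p.1 p.2 else 0) ∈ boundedJets L := by
  refine ⟨fun p => ?_, fun k x hx y hy => ?_⟩
  · rw [mem_closedBall_zero_iff]
    dsimp only
    split_ifs with h
    · exact hL _ _ h
    · simpa using (norm_nonneg _).trans (hL p.1 0 (by simp))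
  · simp only [hx, hy, if_true]
    have hsub : Set.uIcc x y ⊆ Set.Icc 0 1 := Set.uIcc_subset_Icc hx hy
    have h1 : ∀ z ∈ Set.uIcc x y, ‖F (k + 1) z - F (k + 1) x‖ ≤ L (k + 2) * |y - x| := by
      intro z hz
      refine ((convex_Icc (0 : ℝ) 1).norm_image_sub_le_of_norm_hasDerivWithin_le
        (fun w hw => hF (k + 1) w hw) (fun w hw => hL (k + 2) w hw) hx (hsub hz)).trans ?_
      have h2 : 0 ≤ L (k + 2) := (norm_nonneg _).trans (hL (k + 2) x hx)
      have h3 : |z - x| ≤ |y - x| := Set.abs_sub_left_of_mem_uIcc hz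
      rw [Real.norm_eq_abs]
      gcongr
    have h2 := (convex_uIcc x y).norm_image_sub_le_of_norm_hasDerivWithin_le
      (f := fun z => F k z - (z - x : ℝ) * F (k + 1) x)
      (f' := fun z => F (k + 1) z - F (k + 1) x) (fun z hz => by
        have h3 : HasDerivAt (fun z : ℝ => ((z - x : ℝ) : ℂ) * F (k + 1) x)
            (((1 : ℝ) : ℂ) * F (k + 1) x) z :=
          (((hasDerivAt_id z).sub_const x).ofReal_comp).mul_const _
        rw [Complex.ofReal_one, one_mul] at h3
        exact ((hF k z (hsub hz)).mono hsub).sub h3.hasDerivWithinAt)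
      h1 Set.left_mem_uIcc Set.right_mem_uIcc
    simp only [sub_self, Complex.ofReal_zero, zero_mul, sub_zero] at h2
    rw [sub_right_comm] at h2
    refine h2.trans_eq ?_
    rw [Real.norm_eq_abs, mul_assoc, ← sq, sq_abs]

/-- A category argument: if every sequence of zeros and `m k`'s is the jet at the origin of a smooth
function bounded by one of the `L n`, then the multiples `m j` of the unit vectors are jets
of functions bounded by one and the same `2 * L n`, for all but finitely many `j`. -/
theorem exists_uniform_jets (L : ℕ → ℕ → ℝ) (m : ℕ → ℝ)
    (h : ∀ θ : ℕ → Bool, ∃ n, ∃ F : ℕ → ℝ → ℂ, IsJet 1 F ∧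
      (∀ k, ∀ x ∈ Set.Icc (0 : ℝ) 1, ‖F k x‖ ≤ L n k) ∧
      ∀ k, F k 0 = if θ k then (m k : ℂ) else 0) :
    ∃ n, ∃ I : Finset ℕ, ∀ j ∉ I, ∃ F : ℕ → ℝ → ℂ, IsJet 1 F ∧
      (∀ k, ∀ x ∈ Set.Icc (0 : ℝ) 1, ‖F k x‖ ≤ 2 * L n k) ∧
      ∀ k, F k 0 = if k = j then (m j : ℂ) else 0 := by
  let A : ℕ → Set (ℕ → Bool) := fun n =>
    {θ | (fun k => if θ k then (m k : ℂ) else 0) ∈ (fun F k => F (k, 0)) '' boundedJets (L n)}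
  have hclosed : ∀ n, IsClosed (A n) := by
    intro n
    have h1 : IsClosed ((fun (F : ℕ × ℝ → ℂ) (k : ℕ) => F (k, 0)) '' boundedJets (L n)) :=
      ((isCompact_boundedJets (L n)).image (by fun_prop)).isClosed
    refine h1.preimage (continuous_pi fun k => ?_)
    exact (continuous_of_discreteTopology (f := fun b : Bool => if b then (m k : ℂ) else 0)).comp
      (continuous_apply k)
  have hunion : ⋃ n, A n = Set.univ := by
    refine Set.eq_univ_of_forall fun θ => Set.mem_iUnion.2 ?_
    obtain ⟨n, F, hF, hL, h0⟩ := h θ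
    exact ⟨n, _, hF.mem_boundedJets hL, by ext k; simp [h0]⟩
  -- By Baire some `A n` contains a cylinder that fixes only the coordinates in `I`. Both values of
  -- a coordinate `j ∉ I` are then allowed, and the difference of the two functions has the single
  -- entry `m j`.
  obtain ⟨n, θ, hθ⟩ := nonempty_interior_of_iUnion_of_closed hclosed hunion
  obtain ⟨I, u, hu, hsub⟩ := isOpen_pi_iff.1 isOpen_interior θ hθ
  refine ⟨n, I, fun j hj => ?_⟩
  have hval : ∀ b, ∃ F ∈ boundedJets (L n),
      ∀ k, F (k, 0) = if Function.update θ j b k then (m k : ℂ) else 0 := by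
    intro b
    have h1 : Function.update θ j b ∈ (I : Set ℕ).pi u := by
      intro i hi
      rw [Function.update_of_ne (fun e : i = j => hj (e ▸ hi))]
      exact (hu i hi).2
    obtain ⟨F, hF, h2⟩ := interior_subset (hsub h1)
    exact ⟨F, hF, fun k => congrFun h2 k⟩
  obtain ⟨F, hF, hF0⟩ := hval true
  obtain ⟨G, hG, hG0⟩ := hval false
  refine ⟨fun k x => F (k, x) - G (k, x),
    (isJet_of_mem_boundedJets hF).sub (isJet_of_mem_boundedJets hG), fun k x _ => ?_, fun k => ?_⟩
  · refine (norm_sub_le _ _).trans ?_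
    have h1 := mem_closedBall_zero_iff.1 (hF.1 (k, x))
    have h2 := mem_closedBall_zero_iff.1 (hG.1 (k, x))
    simp only at h1 h2
    linarith
  · simp only [hF0, hG0]
    rcases eq_or_ne k j with rfl | hk
    · simp
    · simp [hk]

/-! ### Necessity of the condition -/

/-- Uniform bounds for functions whose jets are the unit vectors multiplied by `M' j` imply
`M' ≺_SV M`. -/
theorem PrecSV.of_jets {M' M : ℕ → ℝ} (hM' : IsPositive M') (hM : IsWeightSequence M)
    (hqa : IsNonQuasianalytic M) {s : ℕ} (hs : 1 ≤ s)
    (h : ∀ j, ∃ F : ℕ → ℝ → ℂ, IsJet 1 F ∧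
      (∀ k, ∀ x ∈ Set.Icc (0 : ℝ) 1, ‖F k x‖ ≤ s * ((s : ℝ) ^ k * M k)) ∧
      ∀ k, F k 0 = if k = j then (M' j : ℂ) else 0) : PrecSV M' M := by
  have hs0 : (1 : ℝ) ≤ s := by exact_mod_cast hs
  have hsum := summable_one_div_quot hqa
  have hnn : ∀ k, 0 ≤ 1 / quot M k := fun k => (one_div_pos.2 (quot_pos hM k)).le
  set T := ∑' k, 1 / quot M k with hT
  have hTj : ∀ j, ∑' k, 1 / quot M (j + k) ≤ T := by
    intro j
    have h1 := (by simpa using hsum 0 : Summable fun k => 1 / quot M k).sum_add_tsum_nat_add j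
    have h2 : 0 ≤ ∑ i ∈ Finset.range j, 1 / quot M i := Finset.sum_nonneg fun i _ => hnn i
    simp only [add_comm _ j] at h1
    linarith
  have hSpos : ∀ j, 0 < ∑' k, 1 / quot M (j + k) := fun j =>
    (hsum j).tsum_pos (fun k => hnn _) 0 (one_div_pos.2 (quot_pos hM _))
  have hT0 : 0 < T := (hSpos 0).trans_le (hTj 0)
  have hlog : 0 < Real.log 2 := Real.log_pos (by norm_num)
  -- The first entry is the constant of `IsJet.monomial_le`; the second keeps the point `c * S` in
  -- the unit interval.
  set c := min (Real.log 2 / (8 * s)) (1 / T) with hc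
  have hc0 : 0 < c := lt_min (by positivity) (by positivity)
  -- The base `2 * s * s` absorbs the factor `2 * s * s ^ i`, since `i < j`.
  refine ⟨2 * s * s, by nlinarith, 1 / c, fun j hj => ?_⟩
  set S := ∑' k, 1 / quot M (j + k) with hS
  have hS0 := hSpos j
  have hj0 : (0 : ℝ) < j := by exact_mod_cast hj
  have : Nonempty (Fin j) := ⟨⟨0, hj⟩⟩
  have hsup : (⨆ i : Fin j, (M' j / (((2 * s * s : ℕ) : ℝ) ^ j * M i)) ^
      (1 / ((j : ℝ) - ((i : ℕ) : ℝ)))) ≤ j / (c * S) := by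
    refine ciSup_le fun i => ?_
    obtain ⟨F, hF, hFM, hF0⟩ := h j
    have hi : (i : ℕ) < j := i.2
    have ht1 : c * S ≤ 1 := by
      calc c * S ≤ 1 / T * T := mul_le_mul (min_le_right _ _) (hTj j) hS0.le (by positivity)
        _ = 1 := by field_simp
    have h1 := hF.monomial_le hM hqa (by linarith) (by linarith) (hM' j) hj hF0 hFM
      (t := c * S) (by positivity) ht1 (by gcongr; exact min_le_left _ _) hi
    have hMi := hM.pos i
    have hM'j := hM' j
    have e1 : (j : ℝ) - ((i : ℕ) : ℝ) = ((j - i : ℕ) : ℝ) := by rw [Nat.cast_sub hi.le]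
    rw [e1, one_div]
    refine (Real.rpow_inv_le_iff_of_pos (by positivity) (by positivity)
      (by exact_mod_cast (by omega : 0 < j - i))).2 ?_
    rw [Real.rpow_natCast, div_pow, div_le_div_iff₀ (by positivity) (by positivity)]
    have hfac : ((j - i)! : ℝ) ≤ (j : ℝ) ^ (j - i) := by
      have : (j - i)! ≤ j ^ (j - i) :=
        (Nat.factorial_le_pow _).trans (Nat.pow_le_pow_left (Nat.sub_le _ _) _)
      exact_mod_cast this
    have hspow : 2 * ((s : ℝ) * (s : ℝ) ^ (i : ℕ)) ≤ (((2 * s * s : ℕ) : ℝ)) ^ j := by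
      have e2 : (((2 * s * s : ℕ) : ℝ)) ^ j = 2 ^ j * (s ^ j * s ^ j) := by
        push_cast
        ring
      rw [e2]
      gcongr
      · exact le_self_pow₀ (by norm_num) (by omega)
      · exact le_self_pow₀ hs0 (by omega)
    have h2 : M' j * (c * S) ^ (j - (i : ℕ)) ≤ 2 * (s * (s ^ (i : ℕ) * M i)) * ((j - i)! : ℝ) := by
      have h3 : ((j - i)! : ℝ) ≠ 0 := by positivity
      calc M' j * (c * S) ^ (j - (i : ℕ))
          = M' j * ((c * S) ^ (j - (i : ℕ)) / ((j - i)! : ℝ)) * ((j - i)! : ℝ) := by field_simp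
        _ ≤ _ := by gcongr
    calc M' j * (c * S) ^ (j - (i : ℕ)) ≤ 2 * (s * (s ^ (i : ℕ) * M i)) * ((j - i)! : ℝ) := h2
      _ = (j - i)! * (2 * ((s : ℝ) * (s : ℝ) ^ (i : ℕ)) * M i) := by ring
      _ ≤ j ^ (j - (i : ℕ)) * ((((2 * s * s : ℕ) : ℝ)) ^ j * M i) := by gcongr
  calc _ ≤ j / (c * S) / j * S := by gcongr
    _ = 1 / c := by
      have h1 : S ≠ 0 := hS0.ne'
      field_simp

/-- Necessity of the Schmets–Valdivia condition. -/
theorem exists_precSV_of_subset {𝔐 : Set.Ioi (0 : ℝ) → ℕ → ℝ}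
    (h𝔐 : IsNonQuasianalyticWeightMatrix 𝔐) {ι : Type*} {𝔐' : ι → ℕ → ℝ}
    (hpos : ∀ i, IsPositive (𝔐' i)) (hsub : seqSpace 𝔐' ⊆ borel '' funSpace 𝔐) (i : ι) :
    ∃ x, PrecSV (𝔐' i) (𝔐 x) := by
  -- The one integer `n + 1` serves as matrix index, rate and constant, so that countably many
  -- bounds suffice for Baire.
  let X : ℕ → Set.Ioi (0 : ℝ) := fun n => ⟨n + 1, by simp only [Set.mem_Ioi]; positivity⟩
  let L : ℕ → ℕ → ℝ := fun n k => ((n + 1 : ℕ) : ℝ) * (((n + 1 : ℕ) : ℝ) ^ k * 𝔐 (X n) k)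
  have hLmono : Monotone L := by
    intro n n' hn k
    have h1 : 𝔐 (X n) k ≤ 𝔐 (X n') k := h𝔐.mono (by
      simp only [X, Subtype.mk_le_mk]
      gcongr) k
    have h2 := ((h𝔐.weight (X n)).pos k).le
    simp only [L]
    gcongr
  have hL2 : ∀ n k, 2 * L n k ≤ L (2 * n + 1) k := by
    intro n k
    have h1 : 𝔐 (X n) k ≤ 𝔐 (X (2 * n + 1)) k := h𝔐.mono (by
      simp only [X, Subtype.mk_le_mk]
      push_cast
      have : (0 : ℝ) ≤ n := by positivity
      linarith) k
    have h2 := ((h𝔐.weight (X n)).pos k).le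
    simp only [L]
    rw [← mul_assoc]
    have h3 : (2 : ℝ) * ((n + 1 : ℕ) : ℝ) = ((2 * n + 1 + 1 : ℕ) : ℝ) := by push_cast; ring
    rw [h3]
    gcongr
    omega
  have hjet : ∀ θ : ℕ → Prop, [DecidablePred θ] → ∃ n, ∃ F : ℕ → ℝ → ℂ, IsJet 1 F ∧
      (∀ k, ∀ x ∈ Set.Icc (0 : ℝ) 1, ‖F k x‖ ≤ L n k) ∧
      ∀ k, F k 0 = if θ k then (𝔐' i k : ℂ) else 0 := by
    intro θ _
    have hmem : (fun k => if θ k then (𝔐' i k : ℂ) else 0) ∈ seqSpace 𝔐' := by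
      refine ⟨i, 1, le_rfl, 1, fun k => ?_⟩
      have := (hpos i k).le
      dsimp only
      split_ifs
      · simp [abs_of_nonneg this]
      · simpa using this
    obtain ⟨f, ⟨hf, hbd⟩, hfθ⟩ := hsub hmem
    obtain ⟨x, σ, hσ, C, hC⟩ := hbd 1
    obtain ⟨n, hn⟩ := exists_nat_ge (max (x : ℝ) (max σ C))
    refine ⟨n, fun k => iteratedDeriv k f, IsJet.of_contDiff hf 1, fun k y hy => ?_, fun k =>
      congrFun hfθ k⟩
    refine (hC y ⟨by simpa using (by linarith [hy.1] : (-1 : ℝ) ≤ y), by simpa using hy.2⟩ k).trans ?_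
    have h1 : 𝔐 x k ≤ 𝔐 (X n) k := h𝔐.mono (by
      simp only [X, ← Subtype.coe_le_coe]
      exact ((le_max_left _ _).trans hn).trans (by linarith)) k
    have h2 := ((h𝔐.weight x).pos k).le
    have h3 : C ≤ ((n + 1 : ℕ) : ℝ) := by
      push_cast
      linarith [(le_max_right (σ : ℝ) C).trans ((le_max_right _ _).trans hn)]
    have h4 : (σ : ℝ) ≤ ((n + 1 : ℕ) : ℝ) := by
      push_cast
      linarith [(le_max_left (σ : ℝ) C).trans ((le_max_right _ _).trans hn)]
    simp only [L]
    gcongr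
  obtain ⟨n₀, I, hI⟩ := exists_uniform_jets L (𝔐' i) fun θ => hjet (fun k => θ k = true)
  choose ν hν using fun j => hjet (fun k => k = j)
  -- The index `2 * n₀ + 1` absorbs the factor 2; the finitely many exceptional degrees enter
  -- through their individual bounds `ν j`.
  let n := max (2 * n₀ + 1) (I.sup ν)
  refine ⟨X n, PrecSV.of_jets (hpos i) (h𝔐.weight _) (h𝔐.nonQuasianalytic _)
    (s := n + 1) (by omega) fun j => ?_⟩
  by_cases hj : j ∈ I
  · obtain ⟨F, hF, hFL, hF0⟩ := hν j
    refine ⟨F, hF, fun k x hx => (hFL k x hx).trans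
      (hLmono ((Finset.le_sup hj).trans (le_max_right _ _)) k), fun k => ?_⟩
    rw [hF0]
    split_ifs with h
    · rw [h]
    · rfl
  · obtain ⟨F, hF, hFL, hF0⟩ := hI j hj
    exact ⟨F, hF, fun k x hx => (hFL k x hx).trans
      ((hL2 n₀ k).trans (hLmono (le_max_left _ _) k)), hF0⟩

/-! ### Iterated averages and cutoff functions -/

/-- The average of `f` over the interval of radius `a` around `x`. -/
noncomputable def average (a : ℝ) (f : ℝ → ℝ) (x : ℝ) : ℝ := (1 / 2) * ∫ u in (-1)..1, f (x + a * u)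

/-- The iterated average over intervals of radii `a 0, …, a (n - 1)`. -/
noncomputable def iterAverage (g : ℝ → ℝ) : ℕ → (ℕ → ℝ) → ℝ → ℝ
  | 0, _ => g
  | n + 1, a => average (a 0) (iterAverage g n fun i => a (i + 1))

/-- The radii may differ so that a single value, viewed as the average of a constant, can be
compared with an average. -/
theorem average_sub_average_le {a b x y δ : ℝ} {f g : ℝ → ℝ} (hf : Continuous f)
    (hg : Continuous g)
    (h : ∀ u ∈ Set.Icc (-1 : ℝ) 1, |f (x + a * u) - g (y + b * u)| ≤ δ) :
    |average a f x - average b g y| ≤ δ := by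
  rw [average, average, ← mul_sub, ← intervalIntegral.integral_sub
    (Continuous.intervalIntegrable (by fun_prop) _ _)
    (Continuous.intervalIntegrable (by fun_prop) _ _), abs_mul]
  have h1 : ‖∫ u in (-1 : ℝ)..1, (f (x + a * u) - g (y + b * u))‖ ≤ δ * |1 - (-1)| :=
    intervalIntegral.norm_integral_le_of_norm_le_const fun u hu => by
      rw [Set.uIoc_of_le (by norm_num)] at hu
      exact h u ⟨hu.1.le, hu.2⟩
  rw [Real.norm_eq_abs] at h1
  norm_num at h1 ⊢
  linarith

theorem average_const (a c x : ℝ) : average a (fun _ => c) x = c := by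
  simp [average]
  ring

theorem hasDerivAt_average {a : ℝ} (ha : 0 < a) {f : ℝ → ℝ} (hf : Continuous f) (x : ℝ) :
    HasDerivAt (average a f) ((1 / (2 * a)) * (f (x + a) - f (x - a))) x := by
  have h1 : average a f = fun x => (1 / (2 * a)) *
      ((∫ t in (0 : ℝ)..(x + a), f t) - ∫ t in (0 : ℝ)..(x - a), f t) := by
    ext x
    rw [average, intervalIntegral.integral_comp_add_mul _ ha.ne',
      intervalIntegral.integral_interval_sub_left (hf.intervalIntegrable _ _)
        (hf.intervalIntegrable _ _), smul_eq_mul]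
    have e1 : x + a * -1 = x - a := by ring
    rw [e1, mul_one]
    field_simp
  rw [h1]
  have h2 : ∀ y, HasDerivAt (fun z => ∫ t in (0 : ℝ)..z, f t) (f y) y := fun y =>
    hf.integral_hasStrictDerivAt 0 y |>.hasDerivAt
  exact (((h2 (x + a)).comp_add_const x a).sub ((h2 (x - a)).comp_sub_const x a)).const_mul _

section

variable {g : ℝ → ℝ} {K : ℝ}

theorem continuous_of_abs_sub_le (hg : ∀ x y, |g x - g y| ≤ K * |x - y|) : Continuous g := by
  have : LipschitzWith (Real.toNNReal K) g := LipschitzWith.of_dist_le_mul fun x y => by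
    rw [Real.dist_eq, Real.dist_eq]
    exact (hg x y).trans (by gcongr; exact Real.le_coe_toNNReal K)
  exact this.continuous

theorem abs_iterAverage_sub_le (hg : ∀ x y, |g x - g y| ≤ K * |x - y|) (n : ℕ) (a : ℕ → ℝ)
    (x y : ℝ) : |iterAverage g n a x - iterAverage g n a y| ≤ K * |x - y| := by
  induction n generalizing a x y with
  | zero => exact hg x y
  | succ n ih =>
    have hc := continuous_of_abs_sub_le (ih fun i => a (i + 1))
    refine average_sub_average_le hc hc fun u _ => ?_
    simpa using ih (fun i => a (i + 1)) (x + a 0 * u) (y + a 0 * u)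

/-- The two iterates differ only by the innermost averaging, which moves values of `g` by at most `K
* a n`; the outer averages do not enlarge this. -/
theorem abs_iterAverage_succ_sub_le (hK : 0 ≤ K) (hg : ∀ x y, |g x - g y| ≤ K * |x - y|) (n : ℕ)
    {a : ℕ → ℝ} (ha : ∀ i, 0 < a i) (x : ℝ) :
    |iterAverage g n a x - iterAverage g (n + 1) a x| ≤ K * a n := by
  induction n generalizing a x with
  | zero =>
    have h0 : iterAverage g 0 a x = average 0 (fun _ => g x) x := (average_const _ _ _).symm
    rw [h0]
    refine average_sub_average_le continuous_const (continuous_of_abs_sub_le hg) fun u hu => ?_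
    refine (hg _ _).trans ?_
    gcongr
    rw [sub_add_cancel_left, abs_neg, abs_mul, abs_of_pos (ha 0)]
    exact mul_le_of_le_one_right (ha 0).le (abs_le.2 hu)
  | succ n ih =>
    exact average_sub_average_le (continuous_of_abs_sub_le (abs_iterAverage_sub_le hg n _))
      (continuous_of_abs_sub_le (abs_iterAverage_sub_le hg (n + 1) _)) fun u _ =>
        ih (a := fun i => a (i + 1)) (fun i => ha (i + 1)) _

theorem iterAverage_eq_const (hg : ∀ x y, |g x - g y| ≤ K * |x - y|) (n : ℕ) {a : ℕ → ℝ}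
    (ha : ∀ i, 0 < a i) {c x : ℝ}
    (hc : ∀ y, |y - x| ≤ ∑ i ∈ Finset.range n, a i → g y = c) : iterAverage g n a x = c := by
  induction n generalizing a x with
  | zero => exact hc x (by simp)
  | succ n ih =>
    have h0 : |iterAverage g (n + 1) a x - average 0 (fun _ => c) x| ≤ 0 := by
      refine average_sub_average_le (continuous_of_abs_sub_le (abs_iterAverage_sub_le hg n _))
        continuous_const fun u hu => ?_
      rw [ih (a := fun i => a (i + 1)) (fun i => ha (i + 1)), sub_self, abs_zero]
      intro y hy
      refine hc y ?_
      rw [Finset.sum_range_succ']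
      have h1 : |a 0 * u| ≤ a 0 := by
        rw [abs_mul, abs_of_pos (ha 0)]
        exact mul_le_of_le_one_right (ha 0).le (abs_le.2 hu)
      calc |y - x| = |(y - (x + a 0 * u)) + a 0 * u| := by ring_nf
        _ ≤ _ := (abs_add_le _ _).trans (add_le_add hy h1)
    rw [average_const] at h0
    exact sub_eq_zero.1 (abs_nonpos_iff.1 h0)

/-- The limit of the iterated averages over intervals of radii `a 0, a 1, …`. -/
noncomputable def limAverage (g : ℝ → ℝ) (a : ℕ → ℝ) (x : ℝ) : ℝ :=
  limUnder atTop fun n => iterAverage g n a x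

theorem tendsto_iterAverage (hK : 0 ≤ K) (hg : ∀ x y, |g x - g y| ≤ K * |x - y|) {a : ℕ → ℝ}
    (ha : ∀ i, 0 < a i) (hs : Summable a) (x : ℝ) :
    Tendsto (fun n => iterAverage g n a x) atTop (𝓝 (limAverage g a x)) :=
  (cauchySeq_of_dist_le_of_summable (fun n => K * a n)
    (fun n => abs_iterAverage_succ_sub_le hK hg n ha x) (hs.mul_left K)).tendsto_limUnder

theorem abs_limAverage_sub_le (hK : 0 ≤ K) (hg : ∀ x y, |g x - g y| ≤ K * |x - y|) {a : ℕ → ℝ}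
    (ha : ∀ i, 0 < a i) (hs : Summable a) (x y : ℝ) :
    |limAverage g a x - limAverage g a y| ≤ K * |x - y| :=
  le_of_tendsto ((tendsto_iterAverage hK hg ha hs x).sub (tendsto_iterAverage hK hg ha hs y)).abs
    (Eventually.of_forall fun n => abs_iterAverage_sub_le hg n a x y)

theorem limAverage_eq_const (hK : 0 ≤ K) (hg : ∀ x y, |g x - g y| ≤ K * |x - y|) {a : ℕ → ℝ}
    (ha : ∀ i, 0 < a i) (hs : Summable a) {c x : ℝ}
    (hc : ∀ y, |y - x| ≤ ∑' i, a i → g y = c) : limAverage g a x = c := by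
  refine tendsto_nhds_unique (tendsto_iterAverage hK hg ha hs x)
    (tendsto_const_nhds.congr fun n => ?_)
  exact (iterAverage_eq_const hg n ha fun y hy =>
    hc y (hy.trans (hs.sum_le_tsum _ fun i _ => (ha i).le))).symm

theorem abs_iterAverage_le (hg : ∀ x y, |g x - g y| ≤ K * |x - y|) (hg1 : ∀ x, |g x| ≤ 1) (n : ℕ)
    (a : ℕ → ℝ) (x : ℝ) : |iterAverage g n a x| ≤ 1 := by
  induction n generalizing a x with
  | zero => exact hg1 x
  | succ n ih =>
    have h := average_sub_average_le (a := a 0) (b := 0) (x := x) (y := 0) (δ := 1)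
      (continuous_of_abs_sub_le (abs_iterAverage_sub_le hg n fun i => a (i + 1)))
      (continuous_const (y := (0 : ℝ))) fun u _ => by simpa using ih (fun i => a (i + 1)) _
    rwa [average_const, sub_zero] at h

theorem abs_limAverage_le (hK : 0 ≤ K) (hg : ∀ x y, |g x - g y| ≤ K * |x - y|)
    (hg1 : ∀ x, |g x| ≤ 1) {a : ℕ → ℝ} (ha : ∀ i, 0 < a i) (hs : Summable a) (x : ℝ) :
    |limAverage g a x| ≤ 1 :=
  le_of_tendsto (tendsto_iterAverage hK hg ha hs x).abs
    (Eventually.of_forall fun n => abs_iterAverage_le hg hg1 n a x)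

theorem limAverage_eq_average (hK : 0 ≤ K) (hg : ∀ x y, |g x - g y| ≤ K * |x - y|)
    (hg1 : ∀ x, |g x| ≤ 1) {a : ℕ → ℝ} (ha : ∀ i, 0 < a i) (hs : Summable a) :
    limAverage g a = average (a 0) (limAverage g fun i => a (i + 1)) := by
  ext x
  have hs' : Summable fun i => a (i + 1) := (summable_nat_add_iff 1).2 hs
  refine tendsto_nhds_unique ((tendsto_add_atTop_iff_nat 1).2 (tendsto_iterAverage hK hg ha hs x)) ?_
  refine Tendsto.const_mul _ ?_
  refine intervalIntegral.tendsto_integral_filter_of_dominated_convergence (fun _ => 1) ?_ ?_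
    (by simp) ?_
  · refine Eventually.of_forall fun n => Continuous.aestronglyMeasurable ?_
    have := continuous_of_abs_sub_le (abs_iterAverage_sub_le hg n fun i => a (i + 1))
    fun_prop
  · exact Eventually.of_forall fun n => Eventually.of_forall fun u _ =>
      abs_iterAverage_le hg hg1 n _ _
  · exact Eventually.of_forall fun u _ => tendsto_iterAverage hK hg (fun i => ha (i + 1)) hs' _

/-- The outermost average splits off by `limAverage_eq_average`; its derivative is a difference
quotient of the limit for the shifted radii, so the successive derivatives cost `1 / a 0`, `1 / a
1`, …. -/
theorem contDiff_limAverage (hK : 0 ≤ K) (hg : ∀ x y, |g x - g y| ≤ K * |x - y|)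
    (hg1 : ∀ x, |g x| ≤ 1) (k : ℕ) {a : ℕ → ℝ} (ha : ∀ i, 0 < a i) (hs : Summable a) :
    ContDiff ℝ k (limAverage g a) ∧
      ∀ x, |iteratedDeriv k (limAverage g a) x| ≤ ∏ i ∈ Finset.range k, 1 / a i := by
  induction k generalizing a with
  | zero =>
    refine ⟨?_, fun x => by simpa using abs_limAverage_le hK hg hg1 ha hs x⟩
    exact contDiff_zero.2 (continuous_of_abs_sub_le (abs_limAverage_sub_le hK hg ha hs))
  | succ k ih =>
    have hs' : Summable fun i => a (i + 1) := (summable_nat_add_iff 1).2 hs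
    obtain ⟨hsm, hbd⟩ := ih (a := fun i => a (i + 1)) (fun i => ha (i + 1)) hs'
    set next := limAverage g fun i => a (i + 1) with h_next
    have hder : ∀ x, HasDerivAt (limAverage g a)
        ((1 / (2 * a 0)) * (next (x + a 0) - next (x - a 0))) x := by
      rw [limAverage_eq_average hK hg hg1 ha hs]
      exact hasDerivAt_average (ha 0) hsm.continuous
    have hderiv : deriv (limAverage g a) =
        fun x => (1 / (2 * a 0)) * (next (x + a 0) - next (x - a 0)) :=
      funext fun x => (hder x).deriv
    have hp : ContDiff ℝ k fun x => next (x + a 0) := hsm.comp (contDiff_id.add contDiff_const)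
    have hm : ContDiff ℝ k fun x => next (x - a 0) := hsm.comp (contDiff_id.sub contDiff_const)
    constructor
    · push_cast
      refine contDiff_succ_iff_deriv.2 ⟨fun x => (hder x).differentiableAt, by simp, ?_⟩
      rw [hderiv]
      exact contDiff_const.mul (hp.sub hm)
    · intro x
      rw [iteratedDeriv_succ', hderiv, iteratedDeriv_const_mul_field,
        iteratedDeriv_fun_sub hp.contDiffAt hm.contDiffAt, iteratedDeriv_comp_add_const,
        iteratedDeriv_comp_sub_const, Finset.prod_range_succ', abs_mul]
      have ha0 := ha 0
      have h1 := abs_sub (iteratedDeriv k next (x + a 0)) (iteratedDeriv k next (x - a 0))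
      have h2 := hbd (x + a 0)
      have h3 := hbd (x - a 0)
      rw [abs_of_pos (by positivity : 0 < 1 / (2 * a 0))]
      calc 1 / (2 * a 0) * |iteratedDeriv k next (x + a 0) - iteratedDeriv k next (x - a 0)|
          ≤ 1 / (2 * a 0) * (2 * ∏ i ∈ Finset.range k, 1 / a (i + 1)) := by
            gcongr
            linarith
        _ = _ := by field_simp

end

/-- Cutoff functions with prescribed bounds on their derivatives. -/
theorem exists_cutoff {a : ℕ → ℝ} (ha : ∀ i, 0 < a i) (hs : Summable a) {R : ℝ}
    (hR : ∑' i, a i ≤ R) :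
    ∃ χ : ℝ → ℝ, ContDiff ℝ ∞ χ ∧ (∀ x, |x| ≤ R → χ x = 1) ∧ (∀ x, 4 * R ≤ |x| → χ x = 0) ∧
      ∀ k x, |iteratedDeriv k χ x| ≤ ∏ i ∈ Finset.range k, 1 / a i := by
  have hR0 : 0 < R := (hs.tsum_pos (fun i => (ha i).le) 0 (ha 0)).trans_le hR
  -- `g` equals 1 up to `2 * R` and vanishes from `3 * R` on; averaging reaches at most `R` further,
  -- whence the radii `R` and `4 * R`.
  let g : ℝ → ℝ := fun x => max 0 (min 1 (3 - 1 / R * |x|))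
  have hK : 0 ≤ 1 / R := by positivity
  have hg : ∀ x y, |g x - g y| ≤ 1 / R * |x - y| := by
    intro x y
    have h1 : |g x - g y| ≤ |min 1 (3 - 1 / R * |x|) - min 1 (3 - 1 / R * |y|)| := by
      refine (abs_max_sub_max_le_max _ _ _ _).trans ?_
      simp
    have h2 : |min 1 (3 - 1 / R * |x|) - min 1 (3 - 1 / R * |y|)| ≤
        |(3 - 1 / R * |x|) - (3 - 1 / R * |y|)| := by
      refine (abs_min_sub_min_le_max _ _ _ _).trans ?_
      simp
    refine h1.trans (h2.trans ?_)
    rw [sub_sub_sub_cancel_left, ← mul_sub, abs_mul, abs_of_nonneg hK, abs_sub_comm x y]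
    exact mul_le_mul_of_nonneg_left (abs_abs_sub_abs_le_abs_sub y x) hK
  have hg1 : ∀ x, |g x| ≤ 1 := fun x => by
    rw [abs_of_nonneg (le_max_left _ _)]
    exact max_le (by norm_num) (min_le_left _ _)
  refine ⟨limAverage g a, contDiff_infty.2 fun k => (contDiff_limAverage hK hg hg1 k ha hs).1,
    fun x hx => ?_, fun x hx => ?_, fun k x => (contDiff_limAverage hK hg hg1 k ha hs).2 x⟩
  · refine limAverage_eq_const hK hg ha hs fun y hy => ?_
    have h1 : |y| ≤ 2 * R := by
      have := abs_sub_abs_le_abs_sub y x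
      linarith
    have h2 : 1 / R * |y| ≤ 2 := by
      rw [one_div_mul_eq_div, div_le_iff₀ hR0]
      exact h1
    simp only [g]
    rw [min_eq_left (by linarith), max_eq_right (by norm_num)]
  · refine limAverage_eq_const hK hg ha hs fun y hy => ?_
    have h1 : 3 * R ≤ |y| := by
      have := abs_sub_abs_le_abs_sub x y
      rw [abs_sub_comm] at this
      linarith
    have h2 : 3 ≤ 1 / R * |y| := by
      rw [one_div_mul_eq_div, le_div_iff₀ hR0]
      exact h1
    simp only [g]
    rw [max_eq_left ((min_le_right _ _).trans (by linarith))]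

/-! ### Localized monomials -/

theorem iteratedDeriv_monomialJet (j k : ℕ) :
    iteratedDeriv k (monomialJet j 0) = monomialJet j k := by
  induction k with
  | zero => exact iteratedDeriv_zero
  | succ k ih =>
    rw [iteratedDeriv_succ, ih]
    exact funext fun x => (hasDerivAt_monomialJet j k x).deriv

theorem contDiff_monomialJet (j : ℕ) : ContDiff ℝ ∞ (monomialJet j 0) := by
  unfold monomialJet
  simp only [Nat.zero_le, if_true]
  fun_prop

theorem iteratedDeriv_ofReal {f : ℝ → ℝ} (hf : ContDiff ℝ ∞ f) (k : ℕ) :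
    iteratedDeriv k (fun x => (f x : ℂ)) = fun x => ((iteratedDeriv k f x : ℝ) : ℂ) := by
  induction k with
  | zero => simp
  | succ k ih =>
    rw [iteratedDeriv_succ, ih]
    ext x
    have h : DifferentiableAt ℝ (iteratedDeriv k f) x :=
      (hf.differentiable_iteratedDeriv k (by exact_mod_cast WithTop.coe_lt_top _)) x
    rw [h.hasDerivAt.ofReal_comp.deriv, iteratedDeriv_succ]

theorem abs_monomialJet_le {j i : ℕ} (hi : i ≤ j) {r x : ℝ} (hr : 0 ≤ r) (hx : |x| ≤ r * j) :
    |monomialJet j i x| ≤ r ^ (j - i) * 3 ^ j := by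
  have h1 : (j : ℝ) ^ (j - i) / ((j - i)! : ℝ) ≤ 3 ^ j :=
    calc (j : ℝ) ^ (j - i) / ((j - i)! : ℝ) ≤ Real.exp j :=
          Real.pow_div_factorial_le_exp _ (Nat.cast_nonneg j) _
      _ = Real.exp 1 ^ j := by rw [← Real.exp_nat_mul, mul_one]
      _ ≤ 3 ^ j := by gcongr; exact Real.exp_one_lt_three.le
  rw [monomialJet, if_pos hi, abs_div, abs_pow, Nat.abs_cast]
  calc |x| ^ (j - i) / ((j - i)! : ℝ) ≤ (r * j) ^ (j - i) / ((j - i)! : ℝ) := by gcongr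
    _ = r ^ (j - i) * ((j : ℝ) ^ (j - i) / ((j - i)! : ℝ)) := by rw [mul_pow, mul_div_assoc]
    _ ≤ _ := by gcongr

theorem le_mul_quot_pow {M : ℕ → ℝ} (hM : IsWeightSequence M) {i j : ℕ} (hij : i ≤ j) :
    M j ≤ M i * quot M j ^ (j - i) := by
  obtain ⟨d, rfl⟩ := Nat.exists_eq_add_of_le hij
  rw [Nat.add_sub_cancel_left]
  have h : ∀ e ≤ d, M (i + e) ≤ M i * quot M (i + d) ^ e := by
    intro e
    induction e with
    | zero => simp
    | succ e ih =>
      intro he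
      have h1 : quot M (i + (e + 1)) ≤ quot M (i + d) := hM.mono (by omega)
      have h2 := ih (by omega)
      have h3 := hM.pos (i + e)
      have h4 := quot_pos hM (i + d)
      rw [← add_assoc, succ_eq_quot_mul hM, pow_succ]
      calc quot M (i + e + 1) * M (i + e) ≤ quot M (i + d) * (M i * quot M (i + d) ^ e) := by
            gcongr
            exact h1
        _ = _ := by ring
  exact h d le_rfl

/-- Smooth functions with the jet of `x ^ j / j!` at the origin and small derivatives. -/
theorem exists_function_with_monomial_jet {M : ℕ → ℝ} (hM : IsWeightSequence M)
    (hqa : IsNonQuasianalytic M) {j : ℕ} (hj : 1 ≤ j) {α C h s m : ℝ} (hα : 0 < α)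
    (hαj : α ≤ quot M j) (hC : 1 ≤ C) (hαC : α * ∑' k, 1 / quot M (j + k) ≤ C * j) (hh : 0 < h)
    (hm : 0 < m) (hmM : ∀ i ≤ j, m ≤ s ^ j * (M i * α ^ (j - i))) :
    ∃ P : ℝ → ℝ, ContDiff ℝ ∞ P ∧ (∀ k, iteratedDeriv k P 0 = if k = j then 1 else 0) ∧
      ∀ k x, m * |iteratedDeriv k P x| ≤ (24 * h * s) ^ j * ((2 * C / h) ^ k * M k) := by
  have hC0 : 0 < C := by linarith
  -- The averaging radii will be proportional to `1 / lam i`. The shift in `quot M (i + 1)` makes `Λ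
  -- (k + 1) / Λ k` equal to `M (k + 1) / M k` for `k ≥ j`, so the bound `hmΛ` propagates beyond
  -- `j`.
  let lam : ℕ → ℝ := fun i => if i < j then α else quot M (i + 1)
  have hlam : ∀ i, α ≤ lam i := by
    intro i
    simp only [lam]
    split_ifs with hi
    · exact le_rfl
    · exact hαj.trans (hM.mono (by omega))
  have hlam0 : ∀ i, 0 < lam i := fun i => hα.trans_le (hlam i)
  let Λ : ℕ → ℝ := fun k => ∏ i ∈ Finset.range k, lam i
  have hΛ0 : ∀ k, 0 < Λ k := fun k => Finset.prod_pos fun i _ => hlam0 i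
  have hΛsucc : ∀ k, Λ (k + 1) = Λ k * lam k := fun k => Finset.prod_range_succ _ _
  have hΛadd : ∀ k i, Λ k * α ^ i ≤ Λ (k + i) := by
    intro k i
    induction i with
    | zero => simp
    | succ i ih =>
      rw [← add_assoc, hΛsucc, pow_succ, ← mul_assoc]
      have := hΛ0 (k + i)
      exact mul_le_mul ih (hlam _) hα.le this.le
  have hΛlow : ∀ k ≤ j, Λ k = α ^ k := by
    intro k hk
    simp only [Λ]
    rw [Finset.prod_congr rfl (g := fun _ => α) fun i hi => ?_]
    · simp
    · have := Finset.mem_range.1 hi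
      simp [lam, show i < j by omega]
  have hmΛ : ∀ k, m * Λ k ≤ s ^ j * (M k * α ^ j) := by
    intro k
    rcases le_total k j with hk | hk
    · rw [hΛlow k hk]
      calc m * α ^ k ≤ s ^ j * (M k * α ^ (j - k)) * α ^ k := by gcongr; exact hmM k hk
        _ = s ^ j * (M k * (α ^ (j - k) * α ^ k)) := by ring
        _ = _ := by rw [← pow_add, Nat.sub_add_cancel hk]
    · induction k, hk using Nat.le_induction with
      | base =>
        rw [hΛlow j le_rfl]
        have h1 := hmM j le_rfl
        rw [Nat.sub_self, pow_zero, mul_one] at h1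
        calc m * α ^ j ≤ s ^ j * M j * α ^ j := by gcongr
          _ = _ := by ring
      | succ k hk ih =>
        rw [hΛsucc, succ_eq_quot_mul hM]
        have h1 : lam k = quot M (k + 1) := by simp [lam, show ¬ k < j by omega]
        have h2 := quot_pos hM (k + 1)
        rw [h1]
        calc m * (Λ k * quot M (k + 1)) = m * Λ k * quot M (k + 1) := by ring
          _ ≤ s ^ j * (M k * α ^ j) * quot M (k + 1) := by gcongr
          _ = _ := by ring
  let a : ℕ → ℝ := fun i => h / (C * lam i)
  have ha : ∀ i, 0 < a i := fun i => by have := hlam0 i; positivity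
  have htail : ∀ i, a (i + j) = h / C * (1 / quot M (j + 1 + i)) := by
    intro i
    simp only [a, lam]
    rw [if_neg (by omega), div_mul_div_comm, mul_one]
    congr 3
    omega
  have hsq := summable_one_div_quot hqa
  have hs : Summable a := by
    refine (summable_nat_add_iff j).1 ?_
    simp only [htail]
    exact (hsq (j + 1)).mul_left _
  have hj0 : (0 : ℝ) < j := by exact_mod_cast hj
  -- The first `j` radii and the tail contribute at most `h * j / α` each; the tail estimate is the
  -- place where `hαC` enters.
  have hR : ∑' i, a i ≤ 2 * h * j / α := by
    rw [← hs.sum_add_tsum_nat_add j]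
    have h1 : ∑ i ∈ Finset.range j, a i ≤ h * j / α := by
      rw [Finset.sum_congr rfl (g := fun _ => h / (C * α)) fun i hi => by
        simp [a, lam, Finset.mem_range.1 hi]]
      rw [Finset.sum_const, Finset.card_range, nsmul_eq_mul, mul_div_assoc', mul_comm (j : ℝ)]
      gcongr
      exact le_mul_of_one_le_left hα.le hC
    have h2 : ∑' i, a (i + j) ≤ h * j / α := by
      simp only [htail]
      rw [tsum_mul_left]
      have h3 : ∑' i, 1 / quot M (j + 1 + i) ≤ ∑' i, 1 / quot M (j + i) :=
        (hsq (j + 1)).tsum_le_tsum (fun i =>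
          one_div_le_one_div_of_le (quot_pos hM _) (hM.mono (by omega))) (hsq j)
      have h4 : ∑' i, 1 / quot M (j + i) ≤ C * j / α := by
        rw [le_div_iff₀ hα, mul_comm]
        exact hαC
      calc h / C * ∑' i, 1 / quot M (j + 1 + i) ≤ h / C * (C * j / α) := by
            gcongr
            exact h3.trans h4
        _ = _ := by field_simp
    calc _ ≤ h * j / α + h * j / α := add_le_add h1 h2
      _ = _ := by ring
  obtain ⟨χ, hχ, hχ1, hχ0, hχb⟩ := exists_cutoff ha hs hR
  have hχb' : ∀ k x, |iteratedDeriv k χ x| ≤ (C / h) ^ k * Λ k := by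
    intro k x
    refine (hχb k x).trans_eq ?_
    have h1 : (C / h) ^ k = ∏ _i ∈ Finset.range k, C / h := by
      rw [Finset.prod_const, Finset.card_range]
    rw [h1, ← Finset.prod_mul_distrib]
    refine Finset.prod_congr rfl fun i _ => ?_
    have := (hlam0 i).ne'
    simp only [a]
    field_simp
  have hR0 : 0 < 2 * h * j / α := by positivity
  refine ⟨monomialJet j 0 * χ, (contDiff_monomialJet j).mul hχ, fun k => ?_, fun k x => ?_⟩
  · have h1 : monomialJet j 0 * χ =ᶠ[𝓝 0] monomialJet j 0 := by
      filter_upwards [Metric.ball_mem_nhds (0 : ℝ) hR0] with y hy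
      rw [mem_ball_zero_iff, Real.norm_eq_abs] at hy
      rw [Pi.mul_apply, hχ1 y hy.le, mul_one]
    rw [h1.iteratedDeriv_eq, iteratedDeriv_monomialJet, monomialJet_zero]
  · have hsj : 0 < s ^ j := by
      have h1 := hmM j le_rfl
      rw [Nat.sub_self, pow_zero, mul_one] at h1
      have := hM.pos j
      exact pos_of_mul_pos_left (hm.trans_le h1) this.le
    have hMk := hM.pos k
    have e24 : (24 * h * s) ^ j = (8 * h) ^ j * 3 ^ j * s ^ j := by
      rw [← mul_pow, ← mul_pow]
      ring
    rcases le_or_gt |x| (4 * (2 * h * j / α)) with hx | hx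
    · rw [iteratedDeriv_mul ((contDiff_monomialJet j).contDiffAt.of_le (by exact_mod_cast le_top))
        (hχ.contDiffAt.of_le (by exact_mod_cast le_top))]
      have hterm : ∀ i ∈ Finset.range (k + 1),
          m * |k.choose i * iteratedDeriv i (monomialJet j 0) x * iteratedDeriv (k - i) χ x| ≤
          (24 * h * s) ^ j * M k * ((1 / (8 * h)) ^ i * (C / h) ^ (k - i) * k.choose i) := by
        intro i hi
        have hik : i ≤ k := by have := Finset.mem_range.1 hi; omega
        rw [iteratedDeriv_monomialJet, abs_mul, abs_mul, Nat.abs_cast]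
        rcases le_or_gt i j with hij | hij
        · have h1 := abs_monomialJet_le hij (r := 8 * h / α) (by positivity)
            (hx.trans_eq (by ring))
          -- Lowering the order by `i` gains `α ^ i`, as every `lam` is at least `α`. The remaining
          -- `α ^ (j - i)` cancels against the size of the monomial on `|x| ≤ 8 * h * j / α`.
          have h2 : m * Λ (k - i) ≤ s ^ j * (M k * α ^ (j - i)) := by
            have h3 := hΛadd (k - i) i
            rw [Nat.sub_add_cancel hik] at h3
            refine le_of_mul_le_mul_right ?_ (pow_pos hα i)
            calc m * Λ (k - i) * α ^ i = m * (Λ (k - i) * α ^ i) := by ring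
              _ ≤ m * Λ k := by gcongr
              _ ≤ s ^ j * (M k * α ^ j) := hmΛ k
              _ = s ^ j * (M k * (α ^ (j - i) * α ^ i)) := by
                rw [← pow_add, Nat.sub_add_cancel hij]
              _ = _ := by ring
          have h4 : (8 * h) ^ j = (8 * h) ^ (j - i) * (8 * h) ^ i := by
            rw [← pow_add, Nat.sub_add_cancel hij]
          calc m * (k.choose i * |monomialJet j i x| * |iteratedDeriv (k - i) χ x|)
              ≤ m * (k.choose i * ((8 * h / α) ^ (j - i) * 3 ^ j) *
                  ((C / h) ^ (k - i) * Λ (k - i))) := by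
                gcongr
                exact hχb' _ _
            _ = k.choose i * ((8 * h / α) ^ (j - i) * 3 ^ j) * (C / h) ^ (k - i) *
                  (m * Λ (k - i)) := by ring
            _ ≤ k.choose i * ((8 * h / α) ^ (j - i) * 3 ^ j) * (C / h) ^ (k - i) *
                  (s ^ j * (M k * α ^ (j - i))) := by gcongr
            _ = _ := by
              rw [e24, h4, div_pow (8 * h) α, one_div, inv_pow]
              field_simp
        · rw [monomialJet, if_neg (by omega), abs_zero, mul_zero, zero_mul, mul_zero, e24]
          positivity
      calc _ ≤ m * ∑ i ∈ Finset.range (k + 1), |k.choose i *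
              iteratedDeriv i (monomialJet j 0) x * iteratedDeriv (k - i) χ x| := by
            gcongr
            exact Finset.abs_sum_le_sum_abs _ _
        _ ≤ ∑ i ∈ Finset.range (k + 1), (24 * h * s) ^ j * M k *
              ((1 / (8 * h)) ^ i * (C / h) ^ (k - i) * k.choose i) := by
            rw [Finset.mul_sum]
            exact Finset.sum_le_sum hterm
        _ = (24 * h * s) ^ j * M k * (1 / (8 * h) + C / h) ^ k := by
            rw [← Finset.mul_sum, add_pow]
        _ ≤ (24 * h * s) ^ j * M k * (2 * C / h) ^ k := by
            have h5 : 1 / (8 * h) + C / h ≤ 2 * C / h := by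
              rw [show 1 / (8 * h) = (1 / 8) / h by field_simp, ← add_div]
              gcongr
              linarith
            have h6 : 0 ≤ (24 * h * s) ^ j := by rw [e24]; positivity
            gcongr
        _ = _ := by ring
    · have h1 : monomialJet j 0 * χ =ᶠ[𝓝 x] fun _ => 0 := by
        filter_upwards [(continuous_abs.tendsto x).eventually (lt_mem_nhds hx)] with y hy
        rw [Pi.mul_apply, hχ0 y hy.le, mul_zero]
      rw [h1.iteratedDeriv_eq, iteratedDeriv_fun_const_zero, abs_zero, mul_zero, e24]
      positivity

/-! ### Sufficiency of the condition -/

/-- The form in which the Schmets–Valdivia condition is used. -/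
theorem PrecSV.exists_scale {M' M : ℕ → ℝ} (hM' : IsPositive M') (hM : IsWeightSequence M)
    (hqa : IsNonQuasianalytic M) (h : PrecSV M' M) :
    ∃ s C : ℝ, 1 ≤ s ∧ 1 ≤ C ∧ ∀ j : ℕ, 1 ≤ j → ∃ α, 0 < α ∧ α ≤ quot M j ∧
      α * ∑' k, 1 / quot M (j + k) ≤ C * j ∧
      ∀ i ≤ j, M' j ≤ s ^ j * (M i * α ^ (j - i)) := by
  obtain ⟨s, hs, C₀, hC₀⟩ := h
  have hs1 : (1 : ℝ) ≤ s := by exact_mod_cast hs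
  set C := max 1 C₀ with hC
  have hC1 : 1 ≤ C := le_max_left _ _
  refine ⟨2 * s * C, C, by nlinarith, hC1, fun j hj => ?_⟩
  set S := ∑' k, 1 / quot M (j + k) with hS
  have hsq := summable_one_div_quot hqa j
  have hnn : ∀ k, 0 ≤ 1 / quot M k := fun k => (one_div_pos.2 (quot_pos hM k)).le
  have hS0 : 0 < S := hsq.tsum_pos (fun k => hnn _) 0 (one_div_pos.2 (quot_pos hM _))
  have hSj : 1 / quot M j ≤ S := hsq.le_tsum 0 fun k _ => hnn _
  have hj0 : (0 : ℝ) < j := by exact_mod_cast hj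
  have hμ := quot_pos hM j
  have hpow : (s : ℝ) ^ j ≤ (2 * s * C) ^ j := by
    gcongr
    nlinarith
  have hlow : ∀ i < j, M' j ≤ (s : ℝ) ^ j * (M i * (C * j / S) ^ (j - i)) := by
    intro i hi
    have h1 := le_ciSup (f := fun i : Fin j => (M' j / ((s : ℝ) ^ j * M i)) ^
      (1 / ((j : ℝ) - ((i : ℕ) : ℝ)))) (Set.finite_range _).bddAbove ⟨i, hi⟩
    have h2 := hC₀ j hj
    have h3 : (⨆ i : Fin j, (M' j / ((s : ℝ) ^ j * M i)) ^ (1 / ((j : ℝ) - ((i : ℕ) : ℝ)))) ≤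
        C * j / S := by
      rw [le_div_iff₀ hS0]
      rw [div_mul_eq_mul_div, div_le_iff₀ hj0] at h2
      refine h2.trans ?_
      gcongr
      exact le_max_right _ _
    have h4 := h1.trans h3
    have hMi := hM.pos i
    have hM'j := hM' j
    rw [← Nat.cast_sub hi.le, one_div] at h4
    have h5 := (Real.rpow_inv_le_iff_of_pos (by positivity) (by positivity)
      (by exact_mod_cast (by omega : 0 < j - i))).1 h4
    rw [Real.rpow_natCast, div_le_iff₀ (by positivity)] at h5
    exact h5.trans_eq (by ring)
  -- The case `i = j` is not part of the relation. It follows from `i = j - 1` and `1 / S ≤ quot M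
  -- j`, the factor `C * j` being absorbed by `(2 * C) ^ j`.
  have htop : M' j ≤ (2 * s * C) ^ j * M j := by
    obtain ⟨d, rfl⟩ : ∃ d, j = d + 1 := ⟨j - 1, by omega⟩
    have h1 := hlow d (by omega)
    rw [Nat.add_sub_cancel_left, pow_one] at h1
    have h2 : C * ((d + 1 : ℕ) : ℝ) / S ≤ C * ((d + 1 : ℕ) : ℝ) * quot M (d + 1) := by
      rw [div_le_iff₀ hS0, mul_assoc]
      refine le_mul_of_one_le_right (by positivity) ?_
      rwa [div_le_iff₀ hμ, mul_comm] at hSj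
    have h3 : C * ((d + 1 : ℕ) : ℝ) ≤ (2 * C) ^ (d + 1) := by
      rw [mul_pow, mul_comm]
      gcongr
      · exact_mod_cast (Nat.lt_two_pow_self).le
      · exact le_self_pow₀ hC1 (by omega)
    have hMd := hM.pos d
    calc M' (d + 1) ≤ (s : ℝ) ^ (d + 1) * (M d * (C * ((d + 1 : ℕ) : ℝ) / S)) := h1
      _ ≤ (s : ℝ) ^ (d + 1) * (M d * ((2 * C) ^ (d + 1) * quot M (d + 1))) := by
        gcongr
        exact h2.trans (by gcongr)
      _ = (2 * s * C) ^ (d + 1) * M (d + 1) := by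
        rw [succ_eq_quot_mul hM d, show 2 * (s : ℝ) * C = s * (2 * C) by ring, mul_pow]
        ring
  -- The cap keeps the scale below all later quotients; when it is active, `M j ≤ M i * quot M j ^
  -- (j - i)` reduces every `i` to `htop`.
  refine ⟨min (quot M j) (C * j / S), lt_min hμ (by positivity), min_le_left _ _, ?_, ?_⟩
  · calc min (quot M j) (C * j / S) * S ≤ C * j / S * S := by gcongr; exact min_le_right _ _
      _ = C * j := by
        have := hS0.ne'
        field_simp
  · intro i hi
    have hMi := hM.pos i
    rcases hi.eq_or_lt with rfl | hi'
    · simpa using htop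
    · rcases min_choice (quot M j) (C * j / S) with h1 | h1 <;> rw [h1]
      · exact htop.trans (by gcongr; exact le_mul_quot_pow hM hi)
      · exact (hlow i hi').trans (by gcongr)

/-- Termwise differentiation of series of smooth functions of one real variable. -/
theorem contDiff_tsum_of_iteratedDeriv {Q : ℕ → ℝ → ℂ} {v : ℕ → ℕ → ℝ}
    (hQ : ∀ j, ContDiff ℝ ∞ (Q j)) (hv : ∀ k, Summable (v k))
    (hQv : ∀ k j x, ‖iteratedDeriv k (Q j) x‖ ≤ v k j) :
    ContDiff ℝ ∞ (fun x => ∑' j, Q j x) ∧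
      ∀ k x, iteratedDeriv k (fun x => ∑' j, Q j x) x = ∑' j, iteratedDeriv k (Q j) x := by
  have hQ' : ∀ j, ContDiff ℝ ((⊤ : ℕ∞) : WithTop ℕ∞) (Q j) := hQ
  have h1 : ∀ (k j : ℕ) (x : ℝ), (k : ℕ∞) ≤ ⊤ → ‖iteratedFDeriv ℝ k (Q j) x‖ ≤ v k j := by
    intro k j x _
    rw [norm_iteratedFDeriv_eq_norm_iteratedDeriv]
    exact hQv k j x
  have h2 : ∀ k : ℕ, (k : ℕ∞) ≤ ⊤ → Summable (v k) := fun k _ => hv k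
  refine ⟨contDiff_tsum hQ' h2 h1, fun k x => ?_⟩
  have h3 : Summable fun j => iteratedFDeriv ℝ k (Q j) x :=
    Summable.of_norm_bounded (hv k) fun j => h1 k j x le_top
  rw [iteratedDeriv_eq_iteratedFDeriv, iteratedFDeriv_tsum hQ' h2 h1 le_top,
    ContinuousMultilinearMap.tsum_eval h3]
  simp only [iteratedDeriv_eq_iteratedFDeriv]

/-- Sufficiency of the Schmets–Valdivia condition: interpolation of a single sequence. -/
theorem PrecSV.exists_function {M' M : ℕ → ℝ} (hM' : IsPositive M') (hM : IsWeightSequence M)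
    (hqa : IsNonQuasianalytic M) (h : PrecSV M' M) {a : ℕ → ℂ} {σ A : ℝ} (hσ : 1 ≤ σ)
    (ha : ∀ k, ‖a k‖ ≤ A * (σ ^ k * M' k)) :
    ∃ f : ℝ → ℂ, ContDiff ℝ ∞ f ∧ (∀ k, iteratedDeriv k f 0 = a k) ∧
      ∃ ρ C : ℝ, 0 < ρ ∧ ∀ k x, ‖iteratedDeriv k f x‖ ≤ C * (ρ ^ k * M k) := by
  obtain ⟨s, C, hs, hC, hscale⟩ := h.exists_scale hM' hM hqa
  have hA : 0 ≤ A := by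
    have h1 := (norm_nonneg _).trans (ha 0)
    rw [pow_zero, one_mul] at h1
    exact nonneg_of_mul_nonneg_left h1 (hM' 0)
  -- Chosen so that `σ * (24 * η * s) = 1 / 2`, the ratio of the geometric series.
  set η := 1 / (48 * s * σ) with hη
  have hη0 : 0 < η := by positivity
  set ρ := 2 * C / η with hρ
  have hρ0 : 0 < ρ := by positivity
  have hP : ∀ j, ∃ P : ℝ → ℝ, ContDiff ℝ ∞ P ∧
      (∀ k, iteratedDeriv k P 0 = if k = j then 1 else 0) ∧
      ∀ k x, ‖a j‖ * |iteratedDeriv k P x| ≤ (A + ‖a 0‖) * (ρ ^ k * M k) * (1 / 2) ^ j := by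
    intro j
    -- The relation says nothing in degree 0; there the constant 1 serves, and `‖a 0‖` in the bound
    -- accounts for it.
    rcases Nat.eq_zero_or_pos j with rfl | hj
    · refine ⟨monomialJet 0 0, contDiff_monomialJet 0, fun k => ?_, fun k x => ?_⟩
      · rw [iteratedDeriv_monomialJet, monomialJet_zero]
      · have hMk := hM.pos k
        rw [iteratedDeriv_monomialJet, monomialJet, pow_zero, mul_one]
        split_ifs with hk
        · obtain rfl : k = 0 := by omega
          simpa [hM.zero] using hA
        · rw [abs_zero, mul_zero]
          positivity
    · obtain ⟨α, hα, hαj, hαC, hαM⟩ := hscale j hj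
      obtain ⟨P, hP, hP0, hPb⟩ := exists_function_with_monomial_jet hM hqa hj hα hαj hC hαC hη0
        (hM' j) hαM
      refine ⟨P, hP, hP0, fun k x => ?_⟩
      have hMk := hM.pos k
      have e1 : σ ^ j * (24 * η * s) ^ j = (1 / 2) ^ j := by
        rw [← mul_pow, hη]
        congr 1
        field_simp
        norm_num
      calc ‖a j‖ * |iteratedDeriv k P x| ≤ A * (σ ^ j * M' j) * |iteratedDeriv k P x| := by
            gcongr
            exact ha j
        _ = A * σ ^ j * (M' j * |iteratedDeriv k P x|) := by ring
        _ ≤ A * σ ^ j * ((24 * η * s) ^ j * (ρ ^ k * M k)) := by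
            exact mul_le_mul_of_nonneg_left (hPb k x) (by positivity)
        _ = A * (ρ ^ k * M k) * (σ ^ j * (24 * η * s) ^ j) := by ring
        _ ≤ _ := by
            rw [e1]
            gcongr
            exact le_add_of_nonneg_right (norm_nonneg _)
  choose P hP hP0 hPb using hP
  let Q : ℕ → ℝ → ℂ := fun j x => a j * (P j x : ℂ)
  have hQ : ∀ j, ContDiff ℝ ∞ (Q j) := fun j =>
    contDiff_const.mul (Complex.ofRealCLM.contDiff.comp (hP j))
  have hQd : ∀ j k x, iteratedDeriv k (Q j) x = a j * ((iteratedDeriv k (P j) x : ℝ) : ℂ) := by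
    intro j k x
    simp only [Q]
    have h1 : ContDiff ℝ ∞ fun y => (P j y : ℂ) := Complex.ofRealCLM.contDiff.comp (hP j)
    rw [iteratedDeriv_const_mul _ (h1.contDiffAt.of_le (by exact_mod_cast le_top)),
      iteratedDeriv_ofReal (hP j)]
  let v : ℕ → ℕ → ℝ := fun k j => (A + ‖a 0‖) * (ρ ^ k * M k) * (1 / 2) ^ j
  have hv : ∀ k, HasSum (v k) ((A + ‖a 0‖) * (ρ ^ k * M k) * 2) := fun k =>
    hasSum_geometric_two.mul_left _
  have hQv : ∀ k j x, ‖iteratedDeriv k (Q j) x‖ ≤ v k j := by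
    intro k j x
    rw [hQd, norm_mul, Complex.norm_real]
    exact hPb j k x
  obtain ⟨hf, hfd⟩ := contDiff_tsum_of_iteratedDeriv hQ (fun k => (hv k).summable) hQv
  refine ⟨fun x => ∑' j, Q j x, hf, fun k => ?_, ρ, (A + ‖a 0‖) * 2, hρ0, fun k x => ?_⟩
  · rw [hfd]
    simp only [hQd, hP0]
    rw [tsum_eq_single k fun j hj => by simp [hj.symm]]
    simp
  · rw [hfd]
    exact (tsum_of_norm_bounded (hv k) fun j => hQv k j x).trans_eq (by ring)

/-- Sufficiency of the Schmets–Valdivia condition. -/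
theorem subset_of_precSV {𝔐 : Set.Ioi (0 : ℝ) → ℕ → ℝ}
    (h𝔐 : IsNonQuasianalyticWeightMatrix 𝔐) {ι : Type*} {𝔐' : ι → ℕ → ℝ}
    (hpos : ∀ i, IsPositive (𝔐' i)) (h : ∀ i, ∃ x, PrecSV (𝔐' i) (𝔐 x)) :
    seqSpace 𝔐' ⊆ borel '' funSpace 𝔐 := by
  rintro a ⟨i, σ, hσ, A, hA⟩
  obtain ⟨x, hx⟩ := h i
  obtain ⟨f, hf, hfa, ρ, C, hρ, hC⟩ := hx.exists_function (hpos i) (h𝔐.weight x)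
    (h𝔐.nonQuasianalytic x) (by exact_mod_cast hσ : (1 : ℝ) ≤ σ) hA
  obtain ⟨n, hn⟩ := exists_nat_ge ρ
  have hC0 : 0 ≤ C := by
    have h1 := (norm_nonneg _).trans (hC 0 0)
    rw [pow_zero, one_mul] at h1
    exact nonneg_of_mul_nonneg_left h1 ((h𝔐.weight x).pos 0)
  refine ⟨f, ⟨hf, fun _ => ⟨x, n, ?_, C, fun y _ k => (hC k y).trans ?_⟩⟩, funext hfa⟩
  · exact_mod_cast hρ.trans_le hn
  · have := (h𝔐.weight x).pos k
    gcongr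

end Ultradiff

theorem mainTheorem5 (𝔐 : Set.Ioi (0 : ℝ) → ℕ → ℝ)
    (h𝔐 : Ultradiff.IsNonQuasianalyticWeightMatrix 𝔐)
    {ι : Type*} (𝔐' : ι → ℕ → ℝ)
    (hpos : ∀ i, Ultradiff.IsPositive (𝔐' i))
    (hliminf : ∀ i, Ultradiff.LiminfRootPos (𝔐' i)) :
    Ultradiff.seqSpace 𝔐' ⊆ Ultradiff.borel '' Ultradiff.funSpace 𝔐 ↔
      ∀ i, ∃ x, Ultradiff.PrecSV (𝔐' i) (𝔐 x) :=
  ⟨Ultradiff.exists_precSV_of_subset h𝔐 hpos, Ultradiff.subset_of_precSV h𝔐 hpos⟩
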